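/- Let $s,m\ge 1$ be integers and let $p(z)=\sum_{i=0}^{s}p_i z^i$ be a complex polynomial of degree $s$ all of whose roots lie on the unit circle; write its roots, listed with multiplicity, as $z_k=e^{2\pi\imath f_k}$ with $f_k\in\mathbb{R}$, $1\le k\le s$. Let $\mathcal S$ be the space of all two-sided complex sequences $x=(x_t)_{t\in\mathbb Z}$ with $$\sum_{\tau=0}^{s}p_\tau x_{t-\tau}=0\qquad\text{for all } t\in\mathbb Z .$$ Let $$\delta_{\min}=\min_{1\le i\ne j\le s}|f_i-f_j|,$$ where $|f_i-f_j|$ denotes the wrap-around distance on the circle $\mathbb R/\mathbb Z$ of length one, i.e. the distance of $f_i-f_j$ to the nearest integer (and $\delta_{\min}=+\infty$ if $s=1$). Let $u>1$ and suppose that $\delta_{\min}\ge u/m$. Then there exists a filter $\phi=(\phi_\tau)_{\tau\in\mathbb Z}$, $\phi_\tau\in\mathbb C$, with $\phi_\tau=0$ for $\tau\notin[0,m]$, such that $$x_t-[\phi*x]_t=0\quad\text{for every }x\in\mathcal S\text{ and }t\in\mathbb Z,\qquad\text{where } [\phi*x]_t=\sum_{\tau\in\mathbb Z}\phi_\tau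 x_{t-\tau},$$ and $$\|\phi\|_2=\Bigl(\sum_{\tau\in\mathbb Z}|\phi_\tau|^2\Bigr)^{1/2}\le\sqrt{\frac{u+1}{u-1}\cdot\frac{s}{m+1}} .$$ Moreover, if $\delta_{\min}\ge 2/m$, then $\phi$ can be chosen so that in addition $\|\phi\|_2\le\sqrt{3s/(m+1)}$. -/

import Mathlib

open Polynomial
open scoped ENNReal

namespace HarmonicFilter

/-- The right-shift operator on two-sided complex sequences: `[Δ x]_t = x_{t-1}`. -/
def shift : Module.End ℂ (ℤ → ℂ) where
  toFun x := fun t => x (t - 1)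
  map_add' _ _ := rfl
  map_smul' _ _ := rfl

theorem shift_pow_apply (n : ℕ) (x : ℤ → ℂ) (t : ℤ) : (shift ^ n) x t = x (t - n) := by
  induction n generalizing t with
  | zero => simp
  | succ n ih =>
    rw [pow_succ']
    change (shift ^ n) x (t - 1) = _
    rw [ih]
    congr 1
    push_cast
    ring

/-- The space of solutions of the homogeneous linear difference equation `p(Δ) x = 0`. -/
noncomputable def solutionSpace (p : ℂ[X]) : Submodule ℂ (ℤ → ℂ) :=
  LinearMap.ker (aeval shift p)

/-- `x` is a solution iff `∑_{τ ≤ deg p} p_τ x_{t-τ} = 0` for every integer `t`. -/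
theorem mem_solutionSpace (p : ℂ[X]) (x : ℤ → ℂ) :
    x ∈ solutionSpace p ↔
      ∀ t : ℤ, ∑ τ ∈ Finset.range (p.natDegree + 1), p.coeff τ * x (t - τ) = 0 := by
  rw [solutionSpace, LinearMap.mem_ker, aeval_eq_sum_range, funext_iff]
  simp [LinearMap.sum_apply, Finset.sum_apply, shift_pow_apply]

/-- The sequences vanishing outside the integer interval `[k, k']`. -/
def seqOn (k k' : ℤ) : Submodule ℂ (ℤ → ℂ) where
  carrier := {x | ∀ t, t ∉ Set.Icc k k' → x t = 0}
  add_mem' hx hy t ht := by simp [hx t ht, hy t ht]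
  zero_mem' _ _ := rfl
  smul_mem' c x hx t ht := by simp [hx t ht]

/-- The convolution `[u * v]_t = ∑_τ u_τ v_{t-τ}` (used here with `u` of finite support). -/
noncomputable def conv (u v : ℤ → ℂ) : ℤ → ℂ :=
  fun t => ∑' τ : ℤ, u τ * v (t - τ)

/-- The `ℓ₂`-norm of a sequence (used here for sequences of finite support). -/
noncomputable def l2norm (x : ℤ → ℂ) : ℝ :=
  Real.sqrt (∑' t : ℤ, ‖x t‖ ^ 2)

/-- The minimal frequency separation `min_{i ≠ j} |f_i - f_j|`, where `|·|` is the wrap-around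
distance on the circle `ℝ / ℤ` of length one, i.e. the distance of `f_i - f_j` to the nearest
integer. It is `∞` when there is only one frequency, and `0` when a frequency is repeated. -/
noncomputable def minSeparation {s : ℕ} (f : Fin s → ℝ) : ℝ≥0∞ :=
  ⨅ (i : Fin s) (j : Fin s) (_ : i ≠ j),
    ENNReal.ofReal (dist (f i : UnitAddCircle) (f j : UnitAddCircle))

end HarmonicFilter

namespace HarmonicFilter

open Finset Matrix
open scoped ComplexOrder

/-! Write `φ(z) = ∑ φ_n z^n`. If `φ` equals 1 at every root of `p`, the roots being distinct, then
`p ∣ φ - 1`, so `φ(Δ)` fixes every solution. This is a linear system `V φ = 1` with an `s × (m+1)`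
Vandermonde matrix `V`, and its minimum-norm solution satisfies `‖φ‖² ≤ s / c` whenever `V Vᴴ ≥ c >
0`.

The lower large sieve (`IsSeparated.posSemidef_gram_sub`) gives `c = m + 1 - 1/δ` for `δ`-separated
frequencies. Summing the geometric series writes the entries of `V Vᴴ` through `1 / sin π(f_r -
f_s)`, so it follows from the Montgomery–Vaughan Hilbert inequality with constant `1/δ`, obtained
from `IsSeparated.abs_eigenvalue_le`. Taking `δ = v/m` and simplifying yields the stated bounds. -/

/-- The real numbers `f i` are pairwise at distance at least `δ` modulo `1`. -/
def IsSeparated {ι : Type*} (δ : ℝ) (f : ι → ℝ) : Prop :=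
  ∀ i j, i ≠ j → ∀ n : ℤ, δ ≤ |f i - f j - n|

theorem IsSeparated.neg {ι : Type*} {δ : ℝ} {f : ι → ℝ} (h : IsSeparated δ f) :
    IsSeparated δ (fun i => -f i) := by
  intro i j hij n
  have := h i j hij (-n)
  rw [← abs_neg]
  convert this using 2
  push_cast
  ring

theorem isSeparated_of_le_minSeparation {s : ℕ} {f : Fin s → ℝ} {δ : ℝ}
    (h : ENNReal.ofReal δ ≤ minSeparation f) : IsSeparated δ f := by
  intro i j hij n
  have h1 : ENNReal.ofReal δ ≤
      ENNReal.ofReal (dist (f i : UnitAddCircle) (f j : UnitAddCircle)) :=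
    h.trans (iInf_le_of_le i (iInf_le_of_le j (iInf_le _ hij)))
  rw [ENNReal.ofReal_le_ofReal_iff dist_nonneg, dist_eq_norm, ← AddCircle.coe_sub,
    UnitAddCircle.norm_eq] at h1
  exact h1.trans (round_le _ _)

theorem IsSeparated.sin_ne_zero {ι : Type*} {δ : ℝ} {f : ι → ℝ} (h : IsSeparated δ f)
    (hδ : 0 < δ) {i j : ι} (hij : i ≠ j) : Real.sin (Real.pi * (f i - f j)) ≠ 0 := by
  intro h0
  obtain ⟨n, hn⟩ := Real.sin_eq_zero_iff.1 h0
  have h1 : (n : ℝ) = f i - f j := by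
    rw [mul_comm] at hn
    exact mul_left_cancel₀ Real.pi_ne_zero hn
  have := h i j hij n
  rw [h1, sub_self, abs_zero] at this
  linarith

/-! ### Trigonometric estimates and sums over separated points -/

theorem cos_le_quartic {x : ℝ} (h0 : 0 ≤ x) (h2 : x ≤ 2) :
    Real.cos x ≤ 1 - x ^ 2 / 2 + x ^ 4 / 24 := by
  have h := Real.sin_ge_sub_cube (x := x / 2) (by linarith)
  have hp : 0 ≤ x / 2 - (x / 2) ^ 3 / 6 := by
    nlinarith [mul_nonneg h0 (sub_nonneg.2 h2), pow_nonneg h0 3, mul_nonneg h0 h0]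
  have h3 := pow_le_pow_left₀ hp h 2
  have h4 : Real.cos x = 1 - 2 * Real.sin (x / 2) ^ 2 := by
    rw [show x = 2 * (x / 2) by ring, Real.cos_two_mul, Real.cos_sq']
    ring_nf
  rw [h4]
  nlinarith [pow_nonneg h0 6]

/-- The Taylor expansions of the two sides agree through order 4. Inserting the quartic bound for
cosine leaves a margin `x^6/24 - x^8/192`, nonnegative since `x² ≤ 4`. -/
theorem sq_mul_one_add_two_cos_le {x : ℝ} (h0 : 0 ≤ x) (h2 : x ≤ Real.pi / 2) :
    x ^ 2 * (1 + 2 * Real.cos x) ≤ 3 * Real.sin x ^ 2 := by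
  have hx2 : x ≤ 2 := h2.trans (by linarith [Real.pi_le_four])
  have hc := cos_le_quartic h0 hx2
  have hc0 : 0 ≤ Real.cos x := Real.cos_nonneg_of_mem_Icc ⟨by linarith, h2⟩
  rw [Real.sin_sq]
  have h1 := pow_le_pow_left₀ hc0 hc 2
  have h3 := mul_le_mul_of_nonneg_left hc (sq_nonneg x)
  have h5 : x ^ 2 ≤ 4 := by nlinarith
  have h6 := mul_le_mul_of_nonneg_left h5 (pow_nonneg h0 6)
  nlinarith [pow_nonneg h0 6]

theorem one_add_two_abs_cos_div_sin_sq_le {x : ℝ} (hx : |x| ≤ 1 / 2) (h0 : x ≠ 0) :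
    (1 + 2 * |Real.cos (Real.pi * x)|) / Real.sin (Real.pi * x) ^ 2 ≤
      3 / Real.pi ^ 2 * (1 / x ^ 2) := by
  have hpi := Real.pi_pos
  have hpos : 0 < |x| := abs_pos.2 h0
  have hle : Real.pi * |x| ≤ Real.pi / 2 := by nlinarith
  have key := sq_mul_one_add_two_cos_le (by positivity) hle
  have hc0 : 0 ≤ Real.cos (Real.pi * |x|) :=
    Real.cos_nonneg_of_mem_Icc ⟨by nlinarith, hle⟩
  have hs0 : 0 < Real.sin (Real.pi * |x|) :=
    Real.sin_pos_of_pos_of_lt_pi (by positivity) (by linarith)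
  have hcos : |Real.cos (Real.pi * x)| = Real.cos (Real.pi * |x|) := by
    rcases abs_cases x with ⟨h, -⟩ | ⟨h, -⟩
    · rw [h] at hc0 ⊢
      exact abs_of_nonneg hc0
    · rw [h, mul_neg, Real.cos_neg] at hc0 ⊢
      exact abs_of_nonneg hc0
  have hsin : Real.sin (Real.pi * x) ^ 2 = Real.sin (Real.pi * |x|) ^ 2 := by
    rcases abs_cases x with ⟨h, -⟩ | ⟨h, -⟩ <;> rw [h]
    rw [mul_neg, Real.sin_neg, neg_sq]
  rw [hcos, hsin, ← sq_abs x, div_mul_div_comm, mul_one, div_le_div_iff₀ (by positivity)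
    (by positivity), ← mul_pow]
  linarith

/-- The integers `⌊e i / δ⌋` are positive and distinct, so the sum is dominated by `ζ(2) / δ²`. -/
theorem sum_one_div_sq_le_of_pos {ι : Type*} {δ : ℝ} (hδ : 0 < δ) (T : Finset ι) (e : ι → ℝ)
    (he : ∀ i ∈ T, δ ≤ e i) (hsep : ∀ i ∈ T, ∀ j ∈ T, i ≠ j → δ ≤ |e i - e j|) :
    ∑ i ∈ T, 1 / e i ^ 2 ≤ Real.pi ^ 2 / 6 / δ ^ 2 := by
  classical
  have hone : ∀ i ∈ T, 1 ≤ ⌊e i / δ⌋₊ := fun i hi =>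
    Nat.le_floor (by rw [Nat.cast_one, le_div_iff₀ hδ, one_mul]; exact he i hi)
  have hinj : Set.InjOn (fun i => ⌊e i / δ⌋₊) (T : Set ι) := by
    intro i hi j hj hij
    by_contra hne
    have hi0 : 0 ≤ e i / δ := div_nonneg (hδ.le.trans (he i hi)) hδ.le
    have hj0 : 0 ≤ e j / δ := div_nonneg (hδ.le.trans (he j hj)) hδ.le
    have h1 := Nat.floor_le hi0
    have h2 := Nat.lt_floor_add_one (e i / δ)
    have h3 := Nat.floor_le hj0
    have h4 := Nat.lt_floor_add_one (e j / δ)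
    simp only at hij
    rw [hij] at h1 h2
    have h5 : |e i / δ - e j / δ| < 1 := abs_lt.2 ⟨by linarith, by linarith⟩
    rw [← sub_div, abs_div, abs_of_pos hδ, div_lt_one hδ] at h5
    exact absurd (hsep i hi j hj hne) (not_le.2 h5)
  calc ∑ i ∈ T, 1 / e i ^ 2
      ≤ ∑ i ∈ T, 1 / ((⌊e i / δ⌋₊ : ℝ) ^ 2) / δ ^ 2 := by
        refine sum_le_sum fun i hi => ?_
        have h1 : (1 : ℝ) ≤ ⌊e i / δ⌋₊ := by exact_mod_cast hone i hi
        have h2 := Nat.floor_le (div_nonneg (hδ.le.trans (he i hi)) hδ.le)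
        rw [le_div_iff₀ hδ] at h2
        rw [div_div, ← mul_pow]
        exact one_div_le_one_div_of_le (by positivity) (pow_le_pow_left₀ (by positivity) h2 2)
    _ = (∑ k ∈ T.image (fun i => ⌊e i / δ⌋₊), 1 / (k : ℝ) ^ 2) / δ ^ 2 := by
        rw [sum_image hinj, sum_div]
    _ ≤ Real.pi ^ 2 / 6 / δ ^ 2 := by
        gcongr
        exact sum_le_hasSum _ (fun k _ => by positivity) hasSum_zeta_two

theorem sum_one_div_sq_le {ι : Type*} {δ : ℝ} (hδ : 0 < δ) (T : Finset ι) (e : ι → ℝ)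
    (he : ∀ i ∈ T, δ ≤ |e i|) (hsep : ∀ i ∈ T, ∀ j ∈ T, i ≠ j → δ ≤ |e i - e j|) :
    ∑ i ∈ T, 1 / e i ^ 2 ≤ Real.pi ^ 2 / 3 / δ ^ 2 := by
  have h1 := sum_one_div_sq_le_of_pos hδ (T.filter fun i => 0 ≤ e i) e
    (fun i hi => by
      rw [mem_filter] at hi
      simpa [abs_of_nonneg hi.2] using he i hi.1)
    (fun i hi j hj => hsep i (mem_filter.1 hi).1 j (mem_filter.1 hj).1)
  have h2 := sum_one_div_sq_le_of_pos hδ (T.filter fun i => ¬ 0 ≤ e i) (fun i => -e i)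
    (fun i hi => by
      rw [mem_filter, not_le] at hi
      simpa [abs_of_neg hi.2] using he i hi.1)
    (fun i hi j hj hij => by
      rw [← abs_neg, show -(-e i - -e j) = e i - e j by ring]
      exact hsep i (mem_filter.1 hi).1 j (mem_filter.1 hj).1 hij)
  rw [← sum_filter_add_sum_filter_not T (fun i => 0 ≤ e i)]
  simp only [neg_sq] at h2
  calc _ ≤ _ := add_le_add h1 h2
    _ = _ := by ring

theorem sin_sq_pi_mul_sub_intCast (x : ℝ) (n : ℤ) :
    Real.sin (Real.pi * (x - n)) ^ 2 = Real.sin (Real.pi * x) ^ 2 := by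
  rw [mul_sub, mul_comm Real.pi (n : ℝ), Real.sin_sub_int_mul_pi, mul_pow,
    ← sq_abs ((-1 : ℝ) ^ n), abs_zpow]
  simp

theorem abs_cos_pi_mul_sub_intCast (x : ℝ) (n : ℤ) :
    |Real.cos (Real.pi * (x - n))| = |Real.cos (Real.pi * x)| := by
  rw [mul_sub, mul_comm Real.pi (n : ℝ), Real.cos_sub_int_mul_pi, abs_mul, abs_zpow]
  simp

/-- Reducing the differences modulo 1 to `[-1/2, 1/2]` makes each term at most `3/π²` times a
reciprocal square. The factor `π²/3` from both signs cancels this exactly, which is why the constant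
is 1. -/
theorem IsSeparated.sum_le {ι : Type*} [Fintype ι] {δ : ℝ} (hδ : 0 < δ) {f : ι → ℝ}
    (h : IsSeparated δ f) (r : ι) :
    ∑ s, (1 + 2 * |Real.cos (Real.pi * (f r - f s))|) / Real.sin (Real.pi * (f r - f s)) ^ 2 ≤
      1 / δ ^ 2 := by
  classical
  set e : ι → ℝ := fun s => f r - f s - round (f r - f s) with he
  have h1 := sum_one_div_sq_le hδ (univ.erase r) e
    (fun i hi => h r i (ne_of_mem_erase hi).symm _)
    (fun i _ j _ hij => by
      have := h j i hij.symm (round (f r - f i) - round (f r - f j))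
      convert this using 2
      simp only [he]
      push_cast
      ring)
  rw [← add_sum_erase _ _ (mem_univ r)]
  -- The term `s = r` is 0 by the convention for division by zero.
  simp only [sub_self, mul_zero, Real.sin_zero, ne_eq, OfNat.ofNat_ne_zero, not_false_eq_true,
    zero_pow, div_zero, zero_add]
  calc _ ≤ ∑ s ∈ univ.erase r, 3 / Real.pi ^ 2 * (1 / e s ^ 2) := by
        refine sum_le_sum fun s hs => ?_
        rw [← sin_sq_pi_mul_sub_intCast _ (round (f r - f s)),
          ← abs_cos_pi_mul_sub_intCast _ (round (f r - f s))]
        refine one_add_two_abs_cos_div_sin_sq_le (abs_sub_round _) ?_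
        exact abs_pos.1 (hδ.trans_le (h r s (ne_of_mem_erase hs).symm _))
    _ ≤ 3 / Real.pi ^ 2 * (Real.pi ^ 2 / 3 / δ ^ 2) := by
        rw [← mul_sum]
        gcongr
    _ = 1 / δ ^ 2 := by
        have := Real.pi_ne_zero
        field_simp

/-! ### The Hilbert inequality for the cosecant kernel -/

/-- The reciprocal sine of `π (f r - f s)`, which is `0` when `r = s`. -/
noncomputable def csc {ι : Type*} (f : ι → ℝ) (r s : ι) : ℝ :=
  (Real.sin (Real.pi * (f r - f s)))⁻¹

/-- The cotangent of `π (f r - f s)`, which is `0` when `r = s`. -/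
noncomputable def cot {ι : Type*} (f : ι → ℝ) (r s : ι) : ℝ :=
  Real.cos (Real.pi * (f r - f s)) * csc f r s

section Kernel

variable {ι : Type*} {f : ι → ℝ} {δ : ℝ}

theorem csc_self (f : ι → ℝ) (r : ι) : csc f r r = 0 := by simp [csc]

theorem cot_self (f : ι → ℝ) (r : ι) : cot f r r = 0 := by simp [cot, csc_self]

theorem csc_swap (f : ι → ℝ) (r s : ι) : csc f r s = -csc f s r := by
  rw [csc, csc, ← inv_neg, ← Real.sin_neg]
  ring_nf

theorem cot_swap (f : ι → ℝ) (r s : ι) : cot f r s = -cot f s r := by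
  rw [cot, cot, csc_swap f r s, ← Real.cos_neg]
  ring_nf

theorem csc_neg (f : ι → ℝ) (r s : ι) : csc (fun i => -f i) r s = -csc f r s := by
  rw [csc, csc, ← inv_neg, ← Real.sin_neg]
  ring_nf

/-- For distinct indices this is the subtraction formula for sine; the `if` terms repair the
coincident cases, where `csc` and `cot` are 0 by convention. -/
theorem IsSeparated.csc_mul_csc [DecidableEq ι] (h : IsSeparated δ f) (hδ : 0 < δ) (r s t : ι) :
    csc f r s * csc f r t = csc f s t * (cot f r s - cot f r t) +
      (if r = s then csc f s t * cot f s t else 0) +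
      (if r = t then csc f s t * cot f s t else 0) + (if s = t then csc f r s ^ 2 else 0) := by
  by_cases hst : s = t
  · subst hst
    simp [csc_self, sq]
  by_cases hrs : r = s
  · subst hrs
    simp [csc_self, cot_self, hst]
  by_cases hrt : r = t
  · subst hrt
    simp [csc_self, cot_self, hst, hrs, cot_swap f r s]
  simp only [hst, hrs, hrt, if_false, add_zero]
  have h1 := h.sin_ne_zero hδ hst
  have h2 := h.sin_ne_zero hδ hrs
  have h3 := h.sin_ne_zero hδ hrt
  have h4 : Real.sin (Real.pi * (f s - f t)) =
      Real.sin (Real.pi * (f r - f t)) * Real.cos (Real.pi * (f r - f s)) -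
      Real.cos (Real.pi * (f r - f t)) * Real.sin (Real.pi * (f r - f s)) := by
    rw [← Real.sin_sub]
    ring_nf
  unfold cot csc
  field_simp
  linear_combination h4

theorem csc_sq_add_two_abs (f : ι → ℝ) (r s : ι) :
    csc f r s ^ 2 + 2 * |csc f r s * cot f r s| =
      (1 + 2 * |Real.cos (Real.pi * (f r - f s))|) / Real.sin (Real.pi * (f r - f s)) ^ 2 := by
  rw [cot, mul_left_comm, abs_mul, abs_mul_self, csc]
  field_simp

/-- The Hermitian matrix with entries `i / sin (π (f r - f s))` off the diagonal. -/
noncomputable def hilbertMatrix (f : ι → ℝ) : Matrix ι ι ℂ :=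
  Matrix.of fun r s => Complex.I * csc f r s

theorem hilbertMatrix_isHermitian (f : ι → ℝ) : (hilbertMatrix f).IsHermitian := by
  ext r s
  simp [hilbertMatrix, csc_swap f s r]

theorem hilbertMatrix_neg (f : ι → ℝ) : hilbertMatrix (fun i => -f i) = -hilbertMatrix f := by
  ext r s
  simp [hilbertMatrix, csc_neg]

variable [Fintype ι]

theorem IsSeparated.sum_csc_mul_csc [DecidableEq ι] (h : IsSeparated δ f) (hδ : 0 < δ)
    (s t : ι) : ∑ r, csc f r s * csc f r t =
      csc f s t * ((∑ r, cot f r s) - ∑ r, cot f r t) + 2 * (csc f s t * cot f s t) +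
        if s = t then ∑ r, csc f r s ^ 2 else 0 := by
  simp_rw [h.csc_mul_csc hδ _ s t, sum_add_distrib, ← mul_sum, sum_sub_distrib]
  simp only [sum_ite_eq', mem_univ, if_true]
  split_ifs with hst
  · ring
  · simp
    ring

/-- An eigenvalue of the skew-symmetric cosecant matrix has absolute value at most `1 / δ`. -/
theorem IsSeparated.abs_eigenvalue_le (h : IsSeparated δ f) (hδ : 0 < δ) {v : ι → ℂ} {ν : ℝ}
    (hv : v ≠ 0) (hev : ∀ r, ∑ s, (csc f r s : ℂ) * v s = Complex.I * ν * v r) :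
    |ν| ≤ 1 / δ := by
  classical
  set E : ℝ := ∑ r, ‖v r‖ ^ 2 with hE
  have hEpos : 0 < E := by
    obtain ⟨i, hi⟩ := Function.ne_iff.1 hv
    exact sum_pos' (fun _ _ => by positivity) ⟨i, mem_univ _, by
      have : 0 < ‖v i‖ := norm_pos_iff.2 hi
      positivity⟩
  set C : ι → ℝ := fun s => ∑ r, cot f r s with hC
  set D : ι → ℝ := fun s => ∑ r, csc f r s ^ 2 with hD
  have hconj : ∀ s, ∑ t, (csc f s t : ℂ) * star (v t) = -(Complex.I * ν) * star (v s) := by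
    intro s
    have := congrArg star (hev s)
    simpa using this
  -- Expand the squared norm of the cosecant matrix applied to `v`, which is `ν² E` by the
  -- eigenvalue equation.
  have hexp : ((ν ^ 2 * E : ℝ) : ℂ) =
      ∑ s, ∑ t, (2 * (csc f s t * cot f s t) : ℝ) * (v s * star (v t)) +
        ∑ s, ((D s * ‖v s‖ ^ 2 : ℝ) : ℂ) := by
    have e1 : ((ν ^ 2 * E : ℝ) : ℂ) =
        ∑ r, (∑ s, (csc f r s : ℂ) * v s) * ∑ t, (csc f r t : ℂ) * star (v t) := by
      simp_rw [hev, hconj, hE]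
      push_cast
      rw [mul_sum]
      refine sum_congr rfl fun r _ => ?_
      have : v r * star (v r) = (‖v r‖ : ℂ) ^ 2 := Complex.mul_conj' _
      linear_combination (-(ν : ℂ) ^ 2) * this + (ν : ℂ) ^ 2 * v r * star (v r) * Complex.I_sq
    have e2 : ∑ r, (∑ s, (csc f r s : ℂ) * v s) * ∑ t, (csc f r t : ℂ) * star (v t) =
        ∑ s, ∑ t, ((∑ r, csc f r s * csc f r t : ℝ) : ℂ) * (v s * star (v t)) := by
      simp_rw [sum_mul_sum]
      rw [sum_comm]
      refine sum_congr rfl fun s _ => ?_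
      rw [sum_comm]
      refine sum_congr rfl fun t _ => ?_
      push_cast
      rw [sum_mul]
      refine sum_congr rfl fun r _ => ?_
      ring
    -- The key cancellation: by skew-symmetry and the eigenvalue equation, the `C s` and `C t` parts
    -- both equal `-iν ∑ C s |v s|²`.
    have e3 : ∑ s, ∑ t, ((csc f s t * (C s - C t) : ℝ) : ℂ) * (v s * star (v t)) = 0 := by
      have a1 : ∑ s, ∑ t, ((csc f s t * C s : ℝ) : ℂ) * (v s * star (v t)) =
          ∑ s, -(Complex.I * ν) * (C s * (v s * star (v s))) := by
        refine sum_congr rfl fun s _ => ?_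
        calc _ = C s * v s * ∑ t, (csc f s t : ℂ) * star (v t) := by
              rw [mul_sum]
              refine sum_congr rfl fun t _ => ?_
              push_cast
              ring
          _ = _ := by
              rw [hconj]
              ring
      have a2 : ∑ s, ∑ t, ((csc f s t * C t : ℝ) : ℂ) * (v s * star (v t)) =
          ∑ s, -(Complex.I * ν) * (C s * (v s * star (v s))) := by
        rw [sum_comm]
        refine sum_congr rfl fun t _ => ?_
        calc _ = -(C t * star (v t)) * ∑ s, (csc f t s : ℂ) * v s := by
              rw [mul_sum]
              refine sum_congr rfl fun s _ => ?_
              rw [csc_swap f s t]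
              push_cast
              ring
          _ = _ := by
              rw [hev]
              ring
      rw [← sub_eq_zero.2 (a1.trans a2.symm), ← sum_sub_distrib]
      refine sum_congr rfl fun s _ => ?_
      rw [← sum_sub_distrib]
      refine sum_congr rfl fun t _ => ?_
      push_cast
      ring
    rw [e1, e2, ← zero_add (∑ s, ∑ t, (2 * (csc f s t * cot f s t) : ℝ) * (v s * star (v t))),
      ← e3, ← sum_add_distrib, ← sum_add_distrib]
    refine sum_congr rfl fun s _ => ?_
    have a3 : ((D s * ‖v s‖ ^ 2 : ℝ) : ℂ) =
        ∑ t, ((if s = t then D s else 0 : ℝ) : ℂ) * (v s * star (v t)) := by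
      rw [sum_eq_single s (fun t _ hts => by simp [hts.symm]) (by simp), if_pos rfl]
      push_cast
      congr 1
      exact (Complex.mul_conj' _).symm
    rw [a3, ← sum_add_distrib, ← sum_add_distrib]
    refine sum_congr rfl fun t _ => ?_
    have e4 : ∑ r, csc f r s * csc f r t = csc f s t * (C s - C t) +
        2 * (csc f s t * cot f s t) + if s = t then D s else 0 := h.sum_csc_mul_csc hδ s t
    rw [e4, Complex.ofReal_add, Complex.ofReal_add]
    ring
  have hbound : ν ^ 2 * E ≤ 1 / δ ^ 2 * E := by
    have hnorm := congrArg norm hexp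
    rw [Complex.norm_real, Real.norm_of_nonneg (by positivity)] at hnorm
    have b1 : ‖∑ s, ∑ t, ((2 * (csc f s t * cot f s t) : ℝ) : ℂ) * (v s * star (v t))‖ ≤
        ∑ s, ∑ t, 2 * |csc f s t * cot f s t| * ‖v s‖ ^ 2 := by
      calc _ ≤ ∑ s, ∑ t, 2 * |csc f s t * cot f s t| * (‖v s‖ * ‖v t‖) := by
            refine norm_sum_le_of_le _ fun s _ => norm_sum_le_of_le _ fun t _ => ?_
            simp [abs_mul]
        _ ≤ ∑ s, ∑ t, (|csc f s t * cot f s t| * ‖v s‖ ^ 2 +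
              |csc f s t * cot f s t| * ‖v t‖ ^ 2) := by
            refine sum_le_sum fun s _ => sum_le_sum fun t _ => ?_
            nlinarith [mul_nonneg (abs_nonneg (csc f s t * cot f s t))
              (sq_nonneg (‖v s‖ - ‖v t‖))]
        _ = _ := by
            simp_rw [sum_add_distrib]
            rw [sum_comm (f := fun s t => |csc f s t * cot f s t| * ‖v t‖ ^ 2),
              ← sum_add_distrib]
            refine sum_congr rfl fun s _ => ?_
            rw [← sum_add_distrib]
            refine sum_congr rfl fun t _ => ?_
            rw [csc_swap f t s, cot_swap f t s, neg_mul_neg]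
            ring
    have b2 : ‖∑ s, ((D s * ‖v s‖ ^ 2 : ℝ) : ℂ)‖ ≤ ∑ s, ∑ t, csc f s t ^ 2 * ‖v s‖ ^ 2 := by
      refine norm_sum_le_of_le _ fun s _ => ?_
      rw [Complex.norm_real, Real.norm_of_nonneg
        (mul_nonneg (sum_nonneg fun _ _ => sq_nonneg _) (sq_nonneg _)), sum_mul]
      refine sum_le_sum fun t _ => ?_
      rw [csc_swap f t s, neg_sq]
    rw [hnorm]
    refine (norm_add_le _ _).trans ((add_le_add b1 b2).trans ?_)
    rw [← sum_add_distrib, hE, mul_sum]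
    refine sum_le_sum fun s _ => ?_
    rw [← sum_add_distrib]
    calc _ = (∑ t, (csc f s t ^ 2 + 2 * |csc f s t * cot f s t|)) * ‖v s‖ ^ 2 := by
          rw [sum_mul]
          refine sum_congr rfl fun t _ => ?_
          ring
      _ ≤ _ := by
          simp_rw [csc_sq_add_two_abs]
          gcongr
          exact h.sum_le hδ s
  have h2 := le_of_mul_le_mul_right hbound hEpos
  rw [← _root_.one_div_pow] at h2
  exact abs_le_of_sq_le_sq h2 (by positivity)

/-- The generalized Hilbert inequality of Montgomery and Vaughan, one-sided form. -/
theorem IsSeparated.posSemidef_sub_hilbertMatrix [DecidableEq ι] (h : IsSeparated δ f)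
    (hδ : 0 < δ) : (((1 / δ : ℝ) : ℂ) • (1 : Matrix ι ι ℂ) - hilbertMatrix f).PosSemidef := by
  have hH : (((1 / δ : ℝ) : ℂ) • (1 : Matrix ι ι ℂ) - hilbertMatrix f).IsHermitian := by
    refine Matrix.IsHermitian.sub ?_ (hilbertMatrix_isHermitian f)
    rw [Matrix.IsHermitian, conjTranspose_smul, conjTranspose_one, Complex.star_def,
      Complex.conj_ofReal]
  rw [hH.posSemidef_iff_eigenvalues_nonneg]
  intro j
  have hne : (hH.eigenvectorBasis j).ofLp ≠ 0 := by
    intro h0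
    exact hH.eigenvectorBasis.toBasis.ne_zero j (by
      rw [OrthonormalBasis.coe_toBasis]
      ext i
      exact congrFun h0 i)
  have hev := hH.mulVec_eigenvectorBasis j
  generalize hH.eigenvalues j = ν at hev ⊢
  set w := (hH.eigenvectorBasis j).ofLp
  -- An eigenvalue `ν` of `1/δ - H` corresponds to the eigenvalue `i(ν - 1/δ)` of the cosecant
  -- matrix.
  have key := h.abs_eigenvalue_le hδ (ν := ν - 1 / δ) hne fun r => by
    have h1 := congrFun hev r
    rw [sub_mulVec, smul_mulVec, one_mulVec] at h1
    simp only [Pi.sub_apply, Pi.smul_apply, smul_eq_mul, mulVec, dotProduct, hilbertMatrix,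
      of_apply, mul_assoc, ← mul_sum, Complex.real_smul] at h1
    push_cast at h1 ⊢
    linear_combination Complex.I * h1 + (∑ s, (csc f r s : ℂ) * w s) * Complex.I_sq
  have := (abs_le.1 key).1
  simp only [Pi.zero_apply]
  linarith

end Kernel

/-! ### The lower large sieve -/

/-- The point `e^{2πi x}` of the unit circle. -/
noncomputable def expi (x : ℝ) : ℂ := Complex.exp (2 * Real.pi * Complex.I * x)

theorem expi_add (x y : ℝ) : expi (x + y) = expi x * expi y := by
  rw [expi, expi, expi, ← Complex.exp_add]
  push_cast
  ring_nf

theorem expi_zero : expi 0 = 1 := by simp [expi]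

theorem expi_nat_mul (n : ℕ) (x : ℝ) : expi (n * x) = expi x ^ n := by
  rw [expi, expi, ← Complex.exp_nat_mul]
  push_cast
  ring_nf

theorem star_expi (x : ℝ) : star (expi x) = expi (-x) := by
  rw [expi, expi, Complex.star_def, ← Complex.exp_conj]
  simp [Complex.conj_ofNat]

theorem expi_sub_expi_neg (x : ℝ) :
    expi (x / 2) - expi (-(x / 2)) = 2 * Complex.I * Real.sin (Real.pi * x) := by
  have h1 : expi (x / 2) = Complex.exp (((Real.pi * x : ℝ) : ℂ) * Complex.I) := by
    rw [expi]
    push_cast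
    ring_nf
  have h2 : expi (-(x / 2)) = Complex.exp (((-(Real.pi * x) : ℝ) : ℂ) * Complex.I) := by
    rw [expi]
    push_cast
    ring_nf
  rw [h1, h2, Complex.exp_mul_I, Complex.exp_mul_I, Complex.ofReal_neg, Complex.cos_neg,
    Complex.sin_neg, Complex.ofReal_sin]
  ring

theorem sum_expi_pow_mul (N : ℕ) (x : ℝ) :
    (∑ n ∈ range N, expi x ^ n) * (2 * Complex.I * Real.sin (Real.pi * x)) =
      expi ((N - 1 / 2) * x) - expi (-(1 / 2) * x) := by
  rw [← expi_sub_expi_neg]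
  have h1 : expi (x / 2) = expi (-(1 / 2) * x) * expi x := by
    rw [← expi_add]
    ring_nf
  have h2 : expi (-(x / 2)) = expi (-(1 / 2) * x) := by ring_nf
  have h3 : expi ((N - 1 / 2) * x) = expi (-(1 / 2) * x) * expi x ^ N := by
    rw [← expi_nat_mul, ← expi_add]
    ring_nf
  rw [h1, h2, h3]
  linear_combination expi (-(1 / 2) * x) * geom_sum_mul (expi x) N

section Gram

variable {ι : Type*}

/-- The Vandermonde matrix with entries `e^{2πi n f_r}`, for `0 ≤ n < N`. -/
noncomputable def fourierMatrix (f : ι → ℝ) (N : ℕ) : Matrix ι (Fin N) ℂ :=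
  Matrix.of fun r n => expi (f r) ^ (n : ℕ)

theorem gram_apply (f : ι → ℝ) (N : ℕ) (r s : ι) :
    (fourierMatrix f N * (fourierMatrix f N)ᴴ) r s = ∑ n ∈ range N, expi (f r - f s) ^ n := by
  rw [mul_apply, ← Fin.sum_univ_eq_sum_range (fun n => expi (f r - f s) ^ n)]
  refine sum_congr rfl fun n _ => ?_
  simp only [fourierMatrix, of_apply, conjTranspose_apply]
  rw [star_pow, star_expi, ← mul_pow, ← expi_add, sub_eq_add_neg]

/-- The unitary diagonal matrix with entries `e^{2πi c f_r}`. -/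
noncomputable def phaseMatrix [DecidableEq ι] (f : ι → ℝ) (c : ℝ) : Matrix ι ι ℂ :=
  Matrix.diagonal fun r => expi (c * f r)

variable [Fintype ι] [DecidableEq ι]

theorem phaseMatrix_conj_apply (f : ι → ℝ) (c : ℝ) (A : Matrix ι ι ℂ) (r s : ι) :
    (phaseMatrix f c * A * (phaseMatrix f c)ᴴ) r s = expi (c * (f r - f s)) * A r s := by
  rw [phaseMatrix, diagonal_conjTranspose, mul_diagonal, diagonal_mul, Pi.star_apply, star_expi,
    mul_right_comm, ← expi_add]
  ring_nf

/-- The geometric sum is a difference of two phases over `2i sin`. Each phase is a unitary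
conjugation of the Hilbert matrix; the opposite sign is absorbed by `f ↦ -f`, and `1/δ` is shared
equally. -/
theorem IsSeparated.gram_eq {f : ι → ℝ} {δ : ℝ} (h : IsSeparated δ f) (hδ : 0 < δ) (N : ℕ) :
    fourierMatrix f N * (fourierMatrix f N)ᴴ - ((N - 1 / δ : ℝ) : ℂ) • (1 : Matrix ι ι ℂ) =
      (1 / 2 : ℂ) • (phaseMatrix f (N - 1 / 2) *
          (((1 / δ : ℝ) : ℂ) • (1 : Matrix ι ι ℂ) - hilbertMatrix f) *
          (phaseMatrix f (N - 1 / 2))ᴴ) +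
        (1 / 2 : ℂ) • (phaseMatrix f (-(1 / 2)) *
          (((1 / δ : ℝ) : ℂ) • (1 : Matrix ι ι ℂ) - hilbertMatrix fun i => -f i) *
          (phaseMatrix f (-(1 / 2)))ᴴ) := by
  ext r s
  rw [Matrix.sub_apply, gram_apply, Matrix.add_apply, Matrix.smul_apply, Matrix.smul_apply,
    Matrix.smul_apply,
    phaseMatrix_conj_apply, phaseMatrix_conj_apply, hilbertMatrix_neg]
  simp only [Matrix.sub_apply, Matrix.smul_apply, Matrix.neg_apply, smul_eq_mul, hilbertMatrix, of_apply]
  by_cases hrs : r = s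
  · subst hrs
    simp only [sub_self, mul_zero, expi_zero, one_apply_eq, csc_self, one_pow, sum_const,
      card_range]
    push_cast
    simp
    ring
  · have hsin := h.sin_ne_zero hδ hrs
    have key := sum_expi_pow_mul N (f r - f s)
    rw [one_apply_ne hrs, csc]
    have hsin' : (Real.sin (Real.pi * (f r - f s)) : ℂ) ≠ 0 := by exact_mod_cast hsin
    set S : ℂ := (Real.sin (Real.pi * (f r - f s)) : ℂ)
    have h2 : ∑ n ∈ range N, expi (f r - f s) ^ n = -(1 / 2) * Complex.I * S⁻¹ *
        (expi ((N - 1 / 2) * (f r - f s)) - expi (-(1 / 2) * (f r - f s))) := by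
      rw [← key]
      field_simp
      linear_combination (∑ n ∈ range N, expi (f r - f s) ^ n) * Complex.I_sq
    rw [h2, Complex.ofReal_inv]
    ring

/-- The lower large sieve inequality for the Gram matrix of separated exponentials. -/
theorem IsSeparated.posSemidef_gram_sub {f : ι → ℝ} {δ : ℝ} (h : IsSeparated δ f) (hδ : 0 < δ)
    (N : ℕ) : (fourierMatrix f N * (fourierMatrix f N)ᴴ -
      ((N - 1 / δ : ℝ) : ℂ) • (1 : Matrix ι ι ℂ)).PosSemidef := by
  have hhalf : (0 : ℂ) ≤ 1 / 2 := by
    rw [show (1 / 2 : ℂ) = ((1 / 2 : ℝ) : ℂ) by push_cast; rfl]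
    exact Complex.zero_le_real.2 (by norm_num)
  rw [h.gram_eq hδ N]
  exact (((h.posSemidef_sub_hilbertMatrix hδ).mul_mul_conjTranspose_same _).smul hhalf).add
    (((h.neg.posSemidef_sub_hilbertMatrix hδ).mul_mul_conjTranspose_same _).smul hhalf)

/-! ### Minimum-norm interpolation -/

theorem star_dotProduct_self {κ : Type*} [Fintype κ] (v : κ → ℂ) :
    star v ⬝ᵥ v = ((∑ k, ‖v k‖ ^ 2 : ℝ) : ℂ) := by
  push_cast
  exact sum_congr rfl fun k _ => Complex.conj_mul' _

/-- The minimum norm solution of `V a = b` has `‖a‖² ≤ ‖b‖² / c` if `V Vᴴ ≥ c`. -/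
theorem exists_mulVec_eq_of_posSemidef {κ : Type*} [Fintype κ] (V : Matrix ι κ ℂ) {c : ℝ}
    (hc : 0 < c) (hV : (V * Vᴴ - (c : ℂ) • (1 : Matrix ι ι ℂ)).PosSemidef) (b : ι → ℂ) :
    ∃ a : κ → ℂ, V *ᵥ a = b ∧ ∑ k, ‖a k‖ ^ 2 ≤ (∑ i, ‖b i‖ ^ 2) / c := by
  have hpos : (V * Vᴴ).PosDef := by
    have h1 : ((c : ℂ) • (1 : Matrix ι ι ℂ)).PosDef :=
      Matrix.PosDef.one.smul (Complex.zero_lt_real.2 hc)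
    simpa using Matrix.PosDef.posSemidef_add hV h1
  have hunit : IsUnit (V * Vᴴ).det := (Matrix.isUnit_iff_isUnit_det _).1 hpos.isUnit
  -- With `a = Vᴴ y`, one has `‖a‖² = ⟨y, b⟩` and `c‖y‖² ≤ ‖a‖²`; Cauchy–Schwarz then gives `c‖a‖² ≤
  -- ‖b‖²`.
  set y : ι → ℂ := (V * Vᴴ)⁻¹ *ᵥ b with hy
  have hGy : (V * Vᴴ) *ᵥ y = b := by
    rw [hy, mulVec_mulVec, mul_nonsing_inv _ hunit, one_mulVec]
  refine ⟨Vᴴ *ᵥ y, by rw [mulVec_mulVec, hGy], ?_⟩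
  set A : ℝ := ∑ k, ‖(Vᴴ *ᵥ y) k‖ ^ 2
  set Y : ℝ := ∑ i, ‖y i‖ ^ 2
  set B : ℝ := ∑ i, ‖b i‖ ^ 2
  have hA : (A : ℂ) = star y ⬝ᵥ b := by
    rw [← star_dotProduct_self, star_mulVec, conjTranspose_conjTranspose, ← hGy,
      ← dotProduct_mulVec, mulVec_mulVec]
  have hcY : c * Y ≤ A := by
    have h1 := hV.dotProduct_mulVec_nonneg y
    rw [sub_mulVec, hGy, smul_mulVec, one_mulVec, dotProduct_sub, dotProduct_smul, ← hA,
      star_dotProduct_self, smul_eq_mul, ← Complex.ofReal_mul, ← Complex.ofReal_sub,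
      Complex.zero_le_real] at h1
    linarith
  have hA0 : 0 ≤ A := sum_nonneg fun _ _ => by positivity
  have hCS : A ^ 2 ≤ Y * B := by
    have h1 : A ≤ ∑ i, ‖y i‖ * ‖b i‖ := by
      have h2 := congrArg norm hA
      rw [Complex.norm_real, Real.norm_of_nonneg hA0] at h2
      rw [h2]
      exact norm_sum_le_of_le _ fun i _ => by simp
    exact (pow_le_pow_left₀ hA0 h1 2).trans (sum_mul_sq_le_sq_mul_sq _ _ _)
  have hB0 : 0 ≤ B := sum_nonneg fun _ _ => by positivity
  rw [le_div_iff₀ hc]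
  rcases hA0.eq_or_lt with h0 | h0
  · rw [← h0, zero_mul]
    exact hB0
  · refine le_of_mul_le_mul_left ?_ h0
    nlinarith [mul_le_mul_of_nonneg_right hcY hB0]

end Gram

/-! ### From coefficient vectors to filters -/

/-- The extension of a finite sequence by zero to a two-sided sequence. -/
noncomputable def extend {m : ℕ} (a : Fin (m + 1) → ℂ) (t : ℤ) : ℂ :=
  if h : 0 ≤ t ∧ t.toNat < m + 1 then a ⟨t.toNat, h.2⟩ else 0

theorem extend_natCast {m : ℕ} (a : Fin (m + 1) → ℂ) (n : Fin (m + 1)) :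
    extend a ((n : ℕ) : ℤ) = a n := by
  exact dif_pos ⟨Int.natCast_nonneg _, by simp [n.is_le]⟩

theorem extend_mem_seqOn {m : ℕ} (a : Fin (m + 1) → ℂ) : extend a ∈ seqOn 0 m := by
  intro t ht
  rw [Set.mem_Icc] at ht
  exact dif_neg (by omega)

theorem tsum_eq_sum_extend {m : ℕ} {α : Type*} [AddCommMonoid α] [TopologicalSpace α]
    (g : ℤ → α) (hg : ∀ t, t ∉ Set.Icc (0 : ℤ) m → g t = 0) :
    ∑' t, g t = ∑ n : Fin (m + 1), g ((n : ℕ) : ℤ) := by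
  rw [tsum_eq_sum (s := univ.image fun n : Fin (m + 1) => ((n : ℕ) : ℤ)), sum_image]
  · intro i _ j _ hij
    exact Fin.ext (by simpa using hij)
  · intro t ht
    refine hg t fun h => ht ?_
    rw [Set.mem_Icc] at h
    exact mem_image.2 ⟨⟨t.toNat, by omega⟩, mem_univ _, by simp [h.1]⟩

theorem l2norm_extend {m : ℕ} (a : Fin (m + 1) → ℂ) :
    l2norm (extend a) = Real.sqrt (∑ n, ‖a n‖ ^ 2) := by
  rw [l2norm, tsum_eq_sum_extend (m := m) _ fun t ht => by
    simp [extend_mem_seqOn a t ht]]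
  simp_rw [extend_natCast]

/-- The polynomial `∑ a_n X^n`. -/
noncomputable def filterPoly {m : ℕ} (a : Fin (m + 1) → ℂ) : ℂ[X] :=
  ∑ n, C (a n) * X ^ (n : ℕ)

theorem aeval_shift_filterPoly {m : ℕ} (a : Fin (m + 1) → ℂ) (x : ℤ → ℂ) (t : ℤ) :
    aeval shift (filterPoly a) x t = conv (extend a) x t := by
  rw [conv, tsum_eq_sum_extend (m := m) _ fun t ht => by simp [extend_mem_seqOn a t ht]]
  simp [filterPoly, extend_natCast, LinearMap.sum_apply, Finset.sum_apply, shift_pow_apply,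
    ← Algebra.smul_def]

theorem sub_conv_eq_zero_of_dvd {m : ℕ} {a : Fin (m + 1) → ℂ} {p : ℂ[X]}
    (h : p ∣ filterPoly a - 1) {x : ℤ → ℂ} (hx : x ∈ solutionSpace p) (t : ℤ) :
    x t - conv (extend a) x t = 0 := by
  obtain ⟨q, hq⟩ := h
  have h1 : aeval shift (filterPoly a - 1) x = 0 := by
    rw [hq, mul_comm, map_mul, Module.End.mul_apply,
      show aeval shift p x = 0 from LinearMap.mem_ker.1 hx, map_zero]
  have h2 := congrFun h1 t
  rw [map_sub, map_one, LinearMap.sub_apply, Pi.sub_apply, aeval_shift_filterPoly] at h2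
  simpa [sub_eq_zero, eq_comm] using h2

theorem IsSeparated.expi_injective {ι : Type*} {δ : ℝ} {f : ι → ℝ} (h : IsSeparated δ f)
    (hδ : 0 < δ) : Function.Injective fun i => expi (f i) := by
  intro i j hij
  by_contra hne
  obtain ⟨n, hn⟩ := Complex.exp_eq_exp_iff_exists_int.1 hij
  have h1 : ((f i : ℝ) : ℂ) = ((f j + n : ℝ) : ℂ) := by
    refine mul_left_cancel₀ Complex.two_pi_I_ne_zero ?_
    push_cast
    linear_combination hn
  have h2 := h i j hne n
  rw [Complex.ofReal_inj.1 h1, add_sub_cancel_left, sub_self, abs_zero] at h2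
  linarith

theorem IsSeparated.exists_filter {s m : ℕ} {p : ℂ[X]} {f : Fin s → ℝ} {δ : ℝ}
    (hp : p ≠ 0) (hroots : p.roots = univ.val.map fun k => expi (f k))
    (h : IsSeparated δ f) (hδ : 0 < δ) (hm : 1 / δ < m + 1) :
    ∃ φ ∈ seqOn 0 m, (∀ x ∈ solutionSpace p, ∀ t : ℤ, x t - conv φ x t = 0) ∧
      l2norm φ ≤ Real.sqrt (s / (m + 1 - 1 / δ)) := by
  have hV := h.posSemidef_gram_sub hδ (m + 1)
  obtain ⟨a, ha, hnorm⟩ := exists_mulVec_eq_of_posSemidef _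
    (by push_cast; linarith) hV (fun _ => 1)
  refine ⟨extend a, extend_mem_seqOn a, fun x hx t => sub_conv_eq_zero_of_dvd ?_ hx t, ?_⟩
  · by_cases h0 : filterPoly a - 1 = 0
    · rw [h0]
      exact dvd_zero p
    -- Separation makes the roots simple, so checking values at the roots suffices.
    refine (IsAlgClosed.splits p).dvd_of_roots_le_roots hp ?_
    rw [hroots, Multiset.le_iff_subset
      ((Multiset.nodup_map_iff_of_injective (h.expi_injective hδ)).2 univ.nodup)]
    intro z hz
    obtain ⟨k, -, rfl⟩ := Multiset.mem_map.1 hz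
    rw [mem_roots h0, IsRoot.def, eval_sub, eval_one, sub_eq_zero, ← congrFun ha k]
    rw [filterPoly, eval_finsetSum]
    refine sum_congr rfl fun n _ => ?_
    simp [fourierMatrix, mul_comm (a n)]
  · rw [l2norm_extend]
    refine Real.sqrt_le_sqrt (hnorm.trans_eq ?_)
    simp

theorem div_sub_div_le {s m w v : ℝ} (hs : 0 ≤ s) (hm : 0 ≤ m) (hw : 1 < w) (hwv : w ≤ v) :
    s / (m + 1 - m / v) ≤ (w + 1) / (w - 1) * (s / (m + 1)) := by
  have h1 : m / v ≤ m / w := div_le_div_of_nonneg_left hm (by linarith) hwv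
  have h2 : (m + 1) * ((w - 1) / (w + 1)) ≤ m + 1 - m / w := by
    rw [← sub_nonneg]
    have : m + 1 - m / w - (m + 1) * ((w - 1) / (w + 1)) =
        (m * (w - 1) + 2 * w) / (w * (w + 1)) := by
      field_simp
      ring
    rw [this]
    have := sub_pos.2 hw
    positivity
  have h3 : 0 < (w - 1) / (w + 1) := div_pos (by linarith) (by linarith)
  calc s / (m + 1 - m / v) ≤ s / ((m + 1) * ((w - 1) / (w + 1))) :=
        div_le_div_of_nonneg_left hs (by positivity) (by linarith)
    _ = (w + 1) / (w - 1) * (s / (m + 1)) := by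
        have := (sub_pos.2 hw).ne'
        field_simp

end HarmonicFilter

theorem mainTheorem5 (s m : ℕ) (hs : 0 < s) (hm : 0 < m)
    (p : Polynomial ℂ) (hdeg : p.natDegree = s) (f : Fin s → ℝ)
    (hroots : p.roots =
      Finset.univ.val.map (fun k : Fin s => Complex.exp (2 * Real.pi * Complex.I * f k)))
    (u : ℝ) (hu : 1 < u)
    (hsep : ENNReal.ofReal (u / m) ≤ HarmonicFilter.minSeparation f) :
    ∃ φ : ℤ → ℂ, φ ∈ HarmonicFilter.seqOn 0 m ∧
      (∀ x ∈ HarmonicFilter.solutionSpace p, ∀ t : ℤ, x t - HarmonicFilter.conv φ x t = 0) ∧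
      HarmonicFilter.l2norm φ ≤ Real.sqrt ((u + 1) / (u - 1) * (s / (m + 1))) ∧
      (ENNReal.ofReal (2 / m) ≤ HarmonicFilter.minSeparation f →
        HarmonicFilter.l2norm φ ≤ Real.sqrt (3 * s / (m + 1))) := by
  have hm' : (0 : ℝ) < m := by exact_mod_cast hm
  have hp : p ≠ 0 := by
    rintro rfl
    simp at hdeg
    omega
  -- One filter must meet both bounds, so the separation used is `max u 2` over `m` whenever `2/m`
  -- is admissible.
  obtain ⟨v, huv, hv, hv2⟩ : ∃ v : ℝ, u ≤ v ∧
      ENNReal.ofReal (v / m) ≤ HarmonicFilter.minSeparation f ∧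
      (ENNReal.ofReal (2 / m) ≤ HarmonicFilter.minSeparation f → 2 ≤ v) := by
    by_cases h2 : ENNReal.ofReal (2 / m) ≤ HarmonicFilter.minSeparation f
    · refine ⟨max u 2, le_max_left _ _, ?_, fun _ => le_max_right _ _⟩
      rcases max_choice u 2 with h | h <;> rw [h] <;> assumption
    · exact ⟨u, le_rfl, hsep, fun h => absurd h h2⟩
  have hv1 : 1 < v := hu.trans_le huv
  have hδ : 0 < v / m := div_pos (by linarith) hm'
  obtain ⟨φ, hφ, hrep, hnorm⟩ := HarmonicFilter.IsSeparated.exists_filter (m := m) hp hroots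
    (HarmonicFilter.isSeparated_of_le_minSeparation hv) hδ (by
      rw [one_div_div]
      have := div_le_self hm'.le hv1.le
      linarith)
  rw [one_div_div] at hnorm
  refine ⟨φ, hφ, hrep, hnorm.trans (Real.sqrt_le_sqrt ?_), fun h2 =>
    hnorm.trans (Real.sqrt_le_sqrt ?_)⟩
  · exact HarmonicFilter.div_sub_div_le s.cast_nonneg hm'.le hu huv
  · refine (HarmonicFilter.div_sub_div_le s.cast_nonneg hm'.le one_lt_two (hv2 h2)).trans_eq ?_
    ring
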